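/- Let $\Sigma=\{a,b\}$. A word $w\in\Sigma^*$ is called Sturmian if it is balanced, i.e. if for any two factors (contiguous subwords) $u,v$ of $w$ of the same length and each letter $x\in\Sigma$ one has $\bigl||u|_x-|v|_x\bigr|\le 1$, where $|z|_x$ denotes the number of occurrences of $x$ in $z$. Let $\mathit{St}$ be the set of all Sturmian words. A word $w\in\Sigma^*$ is a minimal forbidden word for $\mathit{St}$ if $w\notin\mathit{St}$ but every proper factor of $w$ (every factor of $w$ other than $w$ itself) belongs to $\mathit{St}$. Then for every integer $n>1$, the number $\mathit{MF}_{\mathit{St}}(n)$ of minimal forbidden words of length $n$ for $\mathit{St}$ is $$\mathit{MF}_{\mathit{St}}(n)=2\bigl(n-1-\phi(n)\bigr),$$ where $\phi$ is Euler's totient function, i.e. $\phi(n)$ is the number of positive integers at most $n$ that are coprime to $n$. -/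

import Mathlib

/-- A word `w` is balanced if any two factors `u`, `v` of `w` of the same length contain the same
number of each letter up to one. -/
def IsBalancedWord {α : Type*} [DecidableEq α] (w : List α) : Prop :=
  ∀ u v : List α, u <:+: w → v <:+: w → u.length = v.length →
    ∀ x : α, |((u.count x : ℕ) : ℤ) - ((v.count x : ℕ) : ℤ)| ≤ 1

/-- The language `St` of (finite) Sturmian words: the balanced words over a two-letter alphabet,
here `Bool`. -/
def sturmianLanguage : Language Bool :=
  {w : List Bool | IsBalancedWord w}

/-- The set `MF_L` of minimal forbidden words for a language `L`: the words that are not in `L`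
while each of their proper factors is. -/
def minimalForbiddenWords {α : Type*} (L : Language α) : Language α :=
  {w : List α | w ∉ L ∧ ∀ v : List α, v <:+: w → v ≠ w → v ∈ L}

/-- `X(n)`, the number of words of length `n` in the language `X`. -/
noncomputable def wordCount {α : Type*} (X : Language α) (n : ℕ) : ℕ :=
  Set.ncard {w : List α | w ∈ X ∧ w.length = n}

/-! Encode a word by its prefix counts `S`. By minimality, an unbalanced pair of factors must be a
prefix and a suffix of the same length; up to reversal the prefix has more letters `true`. Let `k`
be the least such length. Comparing inner factors of length `k` with the prefix and with the suffix
forces all of them to have exactly `S k - 1` letters `true`, the prefix having one more and the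
suffix one fewer. Once the two end letters are exchanged, the word has period `k`; minimality of `k`
gives `k ∣ n`. Averaging increments over one period then shows that the counts are the integer parts
of `i * c / n`, with `n / k ≥ 2` dividing both `n` and `c` (`eq_swappedCounts`). Conversely, every
`c` in `(0, n)` not coprime to `n` gives such a word (`swappedChristoffel_mem`). There are `n - 1 -
φ(n)` such `c`, and each yields a word and its reversal, all of them distinct. -/

/-! ### Prefix counts and balance -/

/-- The number of letters `true` in the prefix of length `i` of `w`. -/
def prefixCount (w : List Bool) (i : ℕ) : ℤ := ((w.take i).count true : ℤ)

@[simp] lemma prefixCount_zero (w : List Bool) : prefixCount w 0 = 0 := by simp [prefixCount]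

lemma count_take_drop (w : List Bool) (i m : ℕ) :
    (((w.drop i).take m).count true : ℤ) = prefixCount w (i + m) - prefixCount w i := by
  simp [prefixCount, List.take_add, List.count_append]

lemma prefixCount_take_drop (w : List Bool) {i l j : ℕ} (h : j ≤ l) :
    prefixCount ((w.drop i).take l) j = prefixCount w (i + j) - prefixCount w i := by
  rw [← count_take_drop, prefixCount, List.take_take, min_eq_left h]

lemma prefixCount_succ (w : List Bool) {i : ℕ} (h : i < w.length) :
    prefixCount w (i + 1) = prefixCount w i + if w[i] = true then 1 else 0 := by
  rw [prefixCount, prefixCount, List.take_succ_eq_append_getElem h, List.count_append]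
  cases w[i] <;> simp

lemma prefixCount_reverse (w : List Bool) (i : ℕ) :
    prefixCount w.reverse i = prefixCount w w.length - prefixCount w (w.length - i) := by
  have h := congrArg (List.count true) (List.take_append_drop (w.length - i) w)
  rw [List.count_append] at h
  simp only [prefixCount, List.take_reverse, List.count_reverse, List.take_length]
  omega

lemma eq_of_prefixCount_eq {v w : List Bool} (hl : v.length = w.length)
    (h : ∀ i ≤ w.length, prefixCount v i = prefixCount w i) : v = w := by
  refine List.ext_getElem hl fun i hv hw => ?_
  have h1 := prefixCount_succ v hv
  have h2 := prefixCount_succ w hw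
  rw [h i hw.le, h (i + 1) hw] at h1
  cases hvi : v[i] <;> cases hwi : w[i] <;> simp [hvi, hwi] at h1 h2 ⊢ <;> omega

lemma eq_take_drop_of_isInfix {α : Type*} {u w : List α} (h : u <:+: w) :
    ∃ i, i + u.length ≤ w.length ∧ u = (w.drop i).take u.length := by
  obtain ⟨s, t, rfl⟩ := h
  exact ⟨s.length, by simp, by simp⟩

lemma take_drop_isInfix {α : Type*} (w : List α) (i m : ℕ) : (w.drop i).take m <:+: w :=
  (List.take_prefix _ _).isInfix.trans (List.drop_suffix _ _).isInfix

/-- The letter `true` suffices, since the length determines the count of `false`; exchanging `i` and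
`j` supplies the other half of the absolute value. -/
lemma isBalancedWord_iff (w : List Bool) :
    IsBalancedWord w ↔ ∀ i j m : ℕ, i + m ≤ w.length → j + m ≤ w.length →
      prefixCount w (i + m) - prefixCount w i ≤ prefixCount w (j + m) - prefixCount w j + 1 := by
  constructor
  · intro h i j m hi hj
    have := h _ _ (take_drop_isInfix w i m) (take_drop_isInfix w j m)
      (by simp only [List.length_take, List.length_drop]; omega) true
    rw [count_take_drop, count_take_drop, abs_le] at this
    linarith [this.2]
  · intro h u v hu hv huv x
    obtain ⟨i, hi, hu'⟩ := eq_take_drop_of_isInfix hu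
    obtain ⟨j, hj, hv'⟩ := eq_take_drop_of_isInfix hv
    have hcu := count_take_drop w i u.length
    have hcv := count_take_drop w j v.length
    rw [← hu'] at hcu
    rw [← hv'] at hcv
    have h1 := h i j u.length hi (by omega)
    have h2 := h j i u.length (by omega) hi
    rw [← huv] at hcv
    have lu := List.count_false_add_count_true u
    have lv := List.count_false_add_count_true v
    rw [abs_le]
    cases x <;> constructor <;> omega

/-! ### Minimal forbidden words: reversal and a criterion -/

lemma IsBalancedWord.reverse {α : Type*} [DecidableEq α] {w : List α} (h : IsBalancedWord w) :
    IsBalancedWord w.reverse := by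
  intro u v hu hv huv x
  have := h u.reverse v.reverse (by simpa using List.reverse_infix.2 hu)
    (by simpa using List.reverse_infix.2 hv) (by simpa using huv) x
  simpa using this

lemma reverse_mem_minimalForbiddenWords {w : List Bool}
    (h : w ∈ minimalForbiddenWords sturmianLanguage) :
    w.reverse ∈ minimalForbiddenWords sturmianLanguage := by
  refine ⟨fun hw => h.1 ?_, fun v hv hne => ?_⟩
  · have := IsBalancedWord.reverse hw
    rwa [List.reverse_reverse] at this
  · have := h.2 v.reverse (by simpa using List.reverse_infix.2 hv)
      (fun e => hne (by rw [← e, List.reverse_reverse]))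
    have := IsBalancedWord.reverse this
    rwa [List.reverse_reverse] at this

/-- A word is minimal forbidden for the balanced words iff it is not balanced and the only
unbalanced pairs of factors consist of a prefix and a suffix. -/
lemma mem_minimalForbiddenWords_iff (w : List Bool) :
    w ∈ minimalForbiddenWords sturmianLanguage ↔ ¬ IsBalancedWord w ∧
      ∀ i j m : ℕ, i + m ≤ w.length → j + m ≤ w.length →
        (i = 0 → j + m < w.length) → (j = 0 → i + m < w.length) →
        prefixCount w (i + m) - prefixCount w i ≤
          prefixCount w (j + m) - prefixCount w j + 1 := by
  refine and_congr Iff.rfl ⟨fun h i j m hi hj h1 h2 => ?_, fun h v hv hne => ?_⟩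
  · have key : ∀ p l, p + l ≤ w.length → l < w.length → p ≤ i → p ≤ j → i + m ≤ p + l →
        j + m ≤ p + l → prefixCount w (i + m) - prefixCount w i ≤
          prefixCount w (j + m) - prefixCount w j + 1 := by
      intro p l hp hl hpi hpj hi' hj'
      have hlen : ((w.drop p).take l).length = l := by
        simp only [List.length_take, List.length_drop]; omega
      have hb := (isBalancedWord_iff _).1 (h _ (take_drop_isInfix w p l)
        (fun e => by rw [e] at hlen; omega)) (i - p) (j - p) m (by omega) (by omega)
      rw [prefixCount_take_drop _ (by omega), prefixCount_take_drop _ (by omega),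
        prefixCount_take_drop _ (by omega), prefixCount_take_drop _ (by omega)] at hb
      rw [show p + (i - p + m) = i + m by omega, show p + (j - p + m) = j + m by omega,
        show p + (i - p) = i by omega, show p + (j - p) = j by omega] at hb
      linarith
    -- Either both factors avoid the last letter, or one is a suffix; then neither starts at `0`, so
    -- both avoid the first letter.
    by_cases hc : i + m < w.length ∧ j + m < w.length
    · exact key 0 (w.length - 1) (by omega) (by omega) (by omega) (by omega) (by omega) (by omega)
    · exact key 1 (w.length - 1) (by omega) (by omega) (by omega) (by omega) (by omega) (by omega)
  · obtain ⟨p, hp, hv'⟩ := eq_take_drop_of_isInfix hv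
    have hl : v.length < w.length := lt_of_le_of_ne hv.length_le fun e => hne (hv.eq_of_length e)
    refine (isBalancedWord_iff v).2 fun i j m hi hj => ?_
    rw [hv', prefixCount_take_drop _ (by omega), prefixCount_take_drop _ (by omega),
      prefixCount_take_drop _ (by omega), prefixCount_take_drop _ (by omega)]
    have := h (p + i) (p + j) m (by omega) (by omega) (by omega) (by omega)
    simp only [add_assoc] at this ⊢
    linarith

/-! ### Christoffel words with exchanged end letters -/

/-- The word of length `n` whose prefix counts are given by `T`. -/
def wordOfCounts (T : ℕ → ℤ) (n : ℕ) : List Bool :=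
  (List.range n).map fun i => decide (T i < T (i + 1))

@[simp] lemma length_wordOfCounts (T : ℕ → ℤ) (n : ℕ) : (wordOfCounts T n).length = n := by
  simp [wordOfCounts]

lemma prefixCount_wordOfCounts {T : ℕ → ℤ} {n : ℕ} (h0 : T 0 = 0)
    (h : ∀ i < n, T i ≤ T (i + 1) ∧ T (i + 1) ≤ T i + 1) {i : ℕ} (hi : i ≤ n) :
    prefixCount (wordOfCounts T n) i = T i := by
  induction i with
  | zero => simp [h0]
  | succ i ih =>
    rw [prefixCount_succ _ (by simpa using hi), ih (by omega)]
    have := h i hi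
    simp only [wordOfCounts, List.getElem_map, List.getElem_range, decide_eq_true_eq]
    split_ifs <;> omega

/-- The prefix counts of the lower Christoffel path of slope `c / n`, with its first letter
raised and its last letter lowered. -/
def swappedCounts (n c i : ℕ) : ℤ :=
  (i * c / n : ℤ) + (if 0 < i then 1 else 0) - (if n ≤ i then 1 else 0)

/-- The lower Christoffel word of length `n` with `c` letters `true`, with its first and last
letters exchanged. -/
def swappedChristoffel (n c : ℕ) : List Bool := wordOfCounts (swappedCounts n c) n

lemma swappedCounts_of_lt {n c i : ℕ} (h0 : 0 < i) (hi : i < n) :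
    swappedCounts n c i = (i * c / n : ℤ) + 1 := by
  simp [swappedCounts, h0, hi]

lemma swappedCounts_zero {n c : ℕ} (hn : 0 < n) : swappedCounts n c 0 = 0 := by
  simp [swappedCounts, hn.ne']

lemma swappedCounts_self {n c : ℕ} (hn : 0 < n) : swappedCounts n c n = c := by
  simp [swappedCounts, hn, Int.mul_ediv_cancel_left _ (by omega : (n : ℤ) ≠ 0)]

lemma swappedCounts_step {n c : ℕ} (hc : 0 < c) (hcn : c < n) {i : ℕ} (hi : i < n) :
    swappedCounts n c i ≤ swappedCounts n c (i + 1) ∧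
      swappedCounts n c (i + 1) ≤ swappedCounts n c i + 1 := by
  have hn : (0 : ℤ) < n := by omega
  have hcn' : (c : ℤ) < n := by exact_mod_cast hcn
  have hc' : (0 : ℤ) < c := by exact_mod_cast hc
  rcases Nat.eq_zero_or_pos i with rfl | h0
  · rw [swappedCounts_zero (by omega), zero_add, swappedCounts_of_lt one_pos (by omega)]
    simp [Int.ediv_eq_zero_of_lt hc'.le hcn']
  have e1 := Int.mul_ediv_self_le (x := (i * c : ℤ)) hn.ne'
  have e2 := Int.lt_mul_ediv_self_add (x := (i * c : ℤ)) hn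
  rw [swappedCounts_of_lt h0 hi]
  rcases Nat.lt_or_ge (i + 1) n with h | h
  · rw [swappedCounts_of_lt (by omega) h]
    have f1 := Int.mul_ediv_self_le (x := (((i + 1 : ℕ) : ℤ) * c : ℤ)) hn.ne'
    have f2 := Int.lt_mul_ediv_self_add (x := (((i + 1 : ℕ) : ℤ) * c : ℤ)) hn
    push_cast at f1 f2 ⊢
    set a := (i * c : ℤ) / n
    set b := ((i + 1 : ℤ) * c) / n
    constructor
    · have : (n : ℤ) * a < n * (b + 1) := by nlinarith
      have := lt_of_mul_lt_mul_left this hn.le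
      omega
    · have : (n : ℤ) * b < n * (a + 2) := by nlinarith
      have := lt_of_mul_lt_mul_left this hn.le
      omega
  · obtain rfl : n = i + 1 := by omega
    rw [swappedCounts_self (by omega)]
    have : (i * c : ℤ) / ((i + 1 : ℕ) : ℤ) = c - 1 := by
      rw [Int.ediv_eq_iff_of_pos (by omega)]
      push_cast at hcn' ⊢
      constructor <;> nlinarith
    omega

lemma prefixCount_swappedChristoffel {n c : ℕ} (hc : 0 < c) (hcn : c < n) {i : ℕ} (hi : i ≤ n) :
    prefixCount (swappedChristoffel n c) i = swappedCounts n c i :=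
  prefixCount_wordOfCounts (swappedCounts_zero (by omega)) (fun _ => swappedCounts_step hc hcn) hi

/-- A function sandwiched between an affine function and its translate by one has balanced
increments. -/
lemma sub_le_sub_add_one_of_affine_bound {T : ℕ → ℤ} {N β γ : ℤ} (hN : 0 < N) {i j m : ℕ}
    (h : ∀ t ∈ ({i, j, i + m, j + m} : Set ℕ), N * (T t - 1) < γ + t * β ∧ γ + t * β ≤ N * T t) :
    T (i + m) - T i ≤ T (j + m) - T j + 1 := by
  have h1 := h i (by simp)
  have h2 := h j (by simp)
  have h3 := h (i + m) (by simp)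
  have h4 := h (j + m) (by simp)
  push_cast at h3 h4
  have : N * (T (i + m) - T i) < N * (T (j + m) - T j + 2) := by linarith
  have := lt_of_mul_lt_mul_left this hN.le
  omega

/-- With `n = d * k`, `c = d * q` and `d = gcd n c > 1`, the line of slope `c / n` passes through
the lattice points at `k` and `n - k`, so the prefix and suffix of length `k` have counts `q + 1`
and `q - 1`. All other pairs are controlled by a slightly tilted line. -/
lemma swappedChristoffel_mem {n c : ℕ} (hc : 0 < c) (hcn : c < n) (hg : Nat.gcd n c ≠ 1) :
    swappedChristoffel n c ∈ minimalForbiddenWords sturmianLanguage := by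
  have hlen : (swappedChristoffel n c).length = n := length_wordOfCounts _ _
  have hn : (0 : ℤ) < n := by omega
  rw [mem_minimalForbiddenWords_iff, isBalancedWord_iff, hlen]
  constructor
  · intro h
    obtain ⟨k, hk⟩ := Nat.gcd_dvd_left n c
    obtain ⟨q, hq⟩ := Nat.gcd_dvd_right n c
    set d := Nat.gcd n c
    have hk0 : 0 < k := by rcases Nat.eq_zero_or_pos k with rfl | h <;> omega
    have hd0 : d ≠ 0 := by rintro e; rw [e] at hk; omega
    have hkn : k < n := by rw [hk]; nlinarith [show 2 ≤ d by omega]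
    have := h 0 (n - k) k (by omega) (by omega)
    rw [show n - k + k = n by omega, zero_add] at this
    rw [prefixCount_swappedChristoffel hc hcn hkn.le, prefixCount_swappedChristoffel hc hcn le_rfl,
      prefixCount_swappedChristoffel hc hcn (by omega : n - k ≤ n), prefixCount_zero,
      swappedCounts_of_lt hk0 hkn, swappedCounts_self (by omega),
      swappedCounts_of_lt (by omega : 0 < n - k) (by omega), Nat.cast_sub hkn.le] at this
    have e : (k * c : ℤ) = n * q := by
      have : k * c = n * q := by rw [hk, hq]; ring
      exact_mod_cast this
    have e1 : (k * c : ℤ) / n = q := by rw [e, Int.mul_ediv_cancel_left _ hn.ne']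
    have e2 : ((n - k : ℤ) * c) / n = c - q := by
      rw [show ((n - k : ℤ) * c) = n * (c - q) by linarith, Int.mul_ediv_cancel_left _ hn.ne']
    rw [e1, e2] at this
    omega
  · intro i j m hi hj h1 h2
    rw [prefixCount_swappedChristoffel hc hcn hi, prefixCount_swappedChristoffel hc hcn hj,
      prefixCount_swappedChristoffel hc hcn (by omega : i ≤ n),
      prefixCount_swappedChristoffel hc hcn (by omega : j ≤ n)]
    have mid : ∀ t : ℕ, 0 < t → t < n → (n : ℤ) * (swappedCounts n c t - 1) ≤ t * c ∧
        (t : ℤ) * c + 1 ≤ n * swappedCounts n c t := by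
      intro t h0 ht
      rw [swappedCounts_of_lt h0 ht]
      have e1 := Int.mul_ediv_self_le (x := (t * c : ℤ)) hn.ne'
      have e2 := Int.lt_mul_ediv_self_add (x := (t * c : ℤ)) hn
      constructor <;> linarith
    have hN : (0 : ℤ) < n * n := by positivity
    -- The positions `0` and `n` never both occur among the four endpoints. Without `n`, the line
    -- through `(0, 0)` of slope `(c * n + 1) / n²` serves; without `0`, the line through `(n, c)`
    -- of slope `(c * n - 1) / n²`. For `0 < t < n` either tilt puts the line above `t * c / n` by a
    -- positive amount less than `1 / n`, whence the strict bound.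
    by_cases hc : i + m < n ∧ j + m < n
    · have bd : ∀ t < n, (n * n : ℤ) * (swappedCounts n c t - 1) < 0 + t * (c * n + 1) ∧
          0 + t * (c * n + 1) ≤ (n * n : ℤ) * swappedCounts n c t := by
        intro t ht
        rcases Nat.eq_zero_or_pos t with rfl | h0
        · rw [swappedCounts_zero (by omega)]; simp; omega
        · obtain ⟨g1, g2⟩ := mid t h0 ht
          have g1' := mul_le_mul_of_nonneg_left g1 hn.le
          have g2' := mul_le_mul_of_nonneg_left g2 hn.le
          have : (t : ℤ) < n := by exact_mod_cast ht
          have : (0 : ℤ) < t := by exact_mod_cast h0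
          constructor <;> linarith
      refine sub_le_sub_add_one_of_affine_bound hN fun t ht => bd t ?_
      simp only [Set.mem_insert_iff, Set.mem_singleton_iff] at ht
      omega
    · have bd : ∀ t, 0 < t → t ≤ n →
          (n * n : ℤ) * (swappedCounts n c t - 1) < n + t * (c * n - 1) ∧
          n + t * (c * n - 1) ≤ (n * n : ℤ) * swappedCounts n c t := by
        intro t h0 ht
        rcases Nat.lt_or_ge t n with h | h
        · obtain ⟨g1, g2⟩ := mid t h0 h
          have g1' := mul_le_mul_of_nonneg_left g1 hn.le
          have g2' := mul_le_mul_of_nonneg_left g2 hn.le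
          have : (t : ℤ) < n := by exact_mod_cast h
          have : (0 : ℤ) < t := by exact_mod_cast h0
          constructor <;> linarith
        · obtain rfl : t = n := by omega
          rw [swappedCounts_self (by omega)]
          constructor <;> nlinarith
      refine sub_le_sub_add_one_of_affine_bound hN fun t ht => bd t ?_ ?_ <;>
      · simp only [Set.mem_insert_iff, Set.mem_singleton_iff] at ht
        omega

/-! ### Rigidity of the prefix counts -/

/-- If `P` satisfies `P (i + k) = P i + q` on `[0, n]`, and for each `m < k` all increments
`P (i + m) - P i` over a period lie between `P m` and `P m + 1`, the latter bound being strict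
for some `i`, then `P i` is the integer part of `i * q / k`. -/
lemma bounds_of_periodic_increments {P : ℕ → ℤ} {n k : ℕ} {q : ℤ} (hk : 0 < k) (h2 : 2 * k ≤ n)
    (h0 : P 0 = 0) (hper : ∀ i, i + k ≤ n → P (i + k) = P i + q)
    (hlow : ∀ m < k, ∀ i < k, P m ≤ P (i + 1 + m) - P (i + 1))
    (hupp : ∀ m < k, ∀ i < k, P (i + 1 + m) - P (i + 1) ≤ P m + 1) {i : ℕ} (hi : i ≤ n) :
    k * P i ≤ i * q ∧ i * q < k * (P i + 1) := by
  -- Raising `m` by one adds a telescoping sum over a full period, which equals `q`.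
  have hsum : ∀ m < k, ∑ i ∈ Finset.range k, (P (i + 1 + m) - P (i + 1)) = m * q := by
    intro m hm
    induction m with
    | zero => simp
    | succ m ih =>
      have ht := Finset.sum_range_sub (fun i => P (i + 1 + m)) k
      have hp := hper (m + 1) (by omega)
      rw [show m + 1 + k = k + 1 + m by omega] at hp
      rw [zero_add, add_comm 1 m, hp] at ht
      have : ∀ i, P (i + 1 + (m + 1)) - P (i + 1) =
          (P (i + 1 + m) - P (i + 1)) + (P (i + 1 + 1 + m) - P (i + 1 + m)) := fun i => by
        rw [show i + 1 + (m + 1) = i + 1 + 1 + m by omega]; ring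
      simp only [this, Finset.sum_add_distrib, ih (by omega), ht]
      push_cast; ring
  induction i using Nat.strong_induction_on with
  | _ i ih =>
    rcases Nat.lt_or_ge i k with h | h
    · rw [← hsum i h]
      constructor
      · simpa using Finset.card_nsmul_le_sum (Finset.range k) _ (P i)
          fun x hx => hlow i h x (Finset.mem_range.1 hx)
      · have : ∑ x ∈ Finset.range k, (P (x + 1 + i) - P (x + 1)) <
            ∑ x ∈ Finset.range k, (P i + 1) := by
          -- The window starting at `k` is a translate of the prefix, so its increment is exactly `P
          -- i`.
          refine Finset.sum_lt_sum (fun x hx => hupp i h x (Finset.mem_range.1 hx))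
            ⟨k - 1, Finset.mem_range.2 (by omega), ?_⟩
          have hp1 := hper i (by omega)
          have hp2 := hper 0 (by omega)
          rw [show k - 1 + 1 + i = i + k by omega, show k - 1 + 1 = 0 + k by omega, hp1, hp2, h0]
          linarith
        simpa using this
    · obtain ⟨j, rfl⟩ := Nat.exists_eq_add_of_le' h
      obtain ⟨a, b⟩ := ih j (by omega) (by omega)
      rw [hper j hi]
      push_cast
      constructor <;> linarith

lemma add_mul_of_periodic {P : ℕ → ℤ} {n k : ℕ} {q : ℤ}
    (hper : ∀ i, i + k ≤ n → P (i + k) = P i + q) (r a : ℕ) (h : r + k * a ≤ n) :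
    P (r + k * a) = P r + a * q := by
  induction a with
  | zero => simp
  | succ a ih =>
    rw [mul_add, mul_one, ← add_assoc] at h ⊢
    rw [hper _ h, ih (by omega)]
    push_cast; ring

/-- Prefix counts all of whose increments over equal lengths are balanced, except those of a
prefix and a suffix of the same length, are those of `swappedChristoffel`. -/
lemma eq_swappedCounts {S : ℕ → ℤ} {n : ℕ} (h0 : S 0 = 0)
    (hS : ∀ i < n, S i ≤ S (i + 1) ∧ S (i + 1) ≤ S i + 1)
    (H : ∀ i j m : ℕ, i + m ≤ n → j + m ≤ n → (i = 0 → j + m < n) → (j = 0 → i + m < n) →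
      S (i + m) - S i ≤ S (j + m) - S j + 1)
    (hex : ∃ k ≤ n, S n + 2 ≤ S k + S (n - k)) :
    ∃ c : ℕ, 0 < c ∧ c < n ∧ Nat.gcd n c ≠ 1 ∧ ∀ i ≤ n, S i = swappedCounts n c i := by
  classical
  -- The least `k` is taken; its minimality serves to prove `k ∣ n`.
  obtain ⟨hkn, hk⟩ := Nat.find_spec hex
  have hmin : ∀ r < Nat.find hex, r ≤ n → S r + S (n - r) < S n + 2 := fun r hr hrn => by
    have := Nat.find_min hex hr
    push Not at this
    exact this hrn
  generalize Nat.find hex = k at hkn hk hmin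
  have hk0 : k ≠ 0 := by rintro rfl; simp [h0] at hk
  have hkn' : k ≠ n := by rintro rfl; simp [h0] at hk
  have hk1 : k + 1 ≠ n := by
    rintro rfl
    rw [show k + 1 - k = 0 + 1 by omega] at hk
    have := hS 0 (by omega)
    have := hS k (by omega)
    omega
  -- The prefix bounds an inner factor from below by `S k - 1`; the suffix, lighter by at least two,
  -- bounds it from above by the same number.
  have hd : ∀ i, 0 < i → i + k < n → S (i + k) = S i + (S k - 1) := by
    intro i hi hin
    have a := H 0 i k (by omega) hin.le (by omega) (by omega)
    have b := H i (n - k) k hin.le (by omega) (by omega) (by omega)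
    rw [zero_add] at a
    rw [Nat.sub_add_cancel hkn] at b
    omega
  have hlast : S n = S (n - k) + (S k - 2) := by
    have a := H 0 1 k (by omega) (by omega) (by omega) (by omega)
    have b := H 1 (n - k) k (by omega) (by omega) (by omega) (by omega)
    rw [zero_add] at a
    rw [Nat.sub_add_cancel hkn] at b
    omega
  have hS1 : S 1 = 1 := by
    have a := hd 1 one_pos (by omega)
    have b := hS k (by omega)
    have c := hS 0 (by omega)
    rw [add_comm 1 k] at a
    rw [zero_add] at c
    omega
  have hSn : S (n - 1) = S n := by
    have a := hd (n - k - 1) (by omega) (by omega)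
    have b := hS (n - k - 1) (by omega)
    have c := hS (n - 1) (by omega)
    rw [show n - k - 1 + k = n - 1 by omega] at a
    rw [show n - k - 1 + 1 = n - k by omega] at b
    rw [show n - 1 + 1 = n by omega] at c
    omega
  set q : ℤ := S k - 1 with hq
  -- `P` undoes the exchange of the end letters, which makes the periodicity hold up to both ends.
  let P : ℕ → ℤ := fun i => S i - (if 0 < i then 1 else 0) + (if n ≤ i then 1 else 0)
  have hP0 : P 0 = 0 := by simp [P, h0]; omega
  have hPn : P n = S n := by simp [P]; omega
  have hPmid : ∀ i, 0 < i → i < n → P i = S i - 1 := fun i hi hin => by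
    simp [P, hi, hin]
  have hper : ∀ i, i + k ≤ n → P (i + k) = P i + q := by
    intro i hi
    rcases Nat.eq_zero_or_pos i with rfl | hi0
    · rw [zero_add, hP0, hPmid k (by omega) (by omega)]; ring
    rw [hPmid i hi0 (by omega)]
    rcases hi.lt_or_eq with h | h
    · rw [hPmid _ (by omega) h, hd i hi0 h]; ring
    · rw [h, hPn, hlast, show n - k = i by omega]; ring
  -- Otherwise periodicity gives `S r + S (n - r) = S n + 2` for `r = n % k < k`, against
  -- minimality.
  have hmod : n % k = 0 := by
    by_contra hr
    have hrk : n % k < k := Nat.mod_lt _ (by omega)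
    have hdm := Nat.mod_add_div n k
    have hq1 : 0 < k * (n / k) := Nat.mul_pos (by omega) (Nat.div_pos hkn (by omega))
    have a := hmin (n % k) hrk (by omega)
    have b := add_mul_of_periodic hper (n % k) (n / k) (by omega)
    have c := add_mul_of_periodic hper 0 (n / k) (by omega)
    rw [hdm, hPn, hPmid (n % k) (by omega) (by omega)] at b
    rw [zero_add, hPmid _ hq1 (by omega), hP0] at c
    rw [show n - n % k = k * (n / k) by omega] at a
    omega
  obtain ⟨a, ha⟩ := Nat.dvd_of_mod_eq_zero hmod
  have ha2 : 2 ≤ a := by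
    by_contra h
    interval_cases a <;> omega
  have h2k : 2 * k ≤ n := by rw [ha]; nlinarith
  have hnq : S n = a * q := by
    have := add_mul_of_periodic hper 0 a (by omega)
    rwa [zero_add, ← ha, hPn, hP0, zero_add] at this
  have hlow : ∀ m < k, ∀ i < k, P m ≤ P (i + 1 + m) - P (i + 1) := by
    intro m hm i hi
    rcases Nat.eq_zero_or_pos m with rfl | hm0
    · simp [hP0]
    rw [hPmid m hm0 (by omega), hPmid (i + 1 + m) (by omega) (by omega),
      hPmid (i + 1) (by omega) (by omega)]
    have := H 0 (i + 1) m (by omega) (by omega) (by omega) (by omega)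
    rw [zero_add, h0] at this
    linarith
  have hupp : ∀ m < k, ∀ i < k, P (i + 1 + m) - P (i + 1) ≤ P m + 1 := by
    intro m hm i hi
    have hp1 := hper m (by omega)
    have hp2 := hper 0 (by omega)
    rw [zero_add, hP0, zero_add] at hp2
    rw [hPmid (i + 1 + m) (by omega) (by omega), hPmid (i + 1) (by omega) (by omega)]
    -- The comparison is with the window starting at `k`, whose increment is `P m` by periodicity.
    have := H (i + 1) k m (by omega) (by omega) (by omega) (by omega)
    rw [hPmid k (by omega) (by omega)] at hp2
    rw [hPmid (m + k) (by omega) (by omega), add_comm m k] at hp1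
    linarith
  have hbd := fun i (hi : i ≤ n) =>
    bounds_of_periodic_increments (by omega) h2k hP0 hper hlow hupp hi
  have hmono : ∀ i, i ≤ n → 0 < i → 1 ≤ S i := by
    intro i hi hi0
    induction i with
    | zero => omega
    | succ i ih =>
      rcases Nat.eq_zero_or_pos i with rfl | h
      · exact hS1.ge
      · exact (ih (by omega) h).trans (hS i hi).1
  have hlt : ∀ i, i ≤ n → S i ≤ i := by
    intro i hi
    induction i with
    | zero => simp [h0]
    | succ i ih =>
      have := ih (by omega)
      have := (hS i hi).2
      push_cast; omega
  have hSn0 := hmono n le_rfl (by omega)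
  have hSn1 := hlt (n - 1) (by omega)
  obtain ⟨c, hc⟩ := Int.eq_ofNat_of_zero_le (by omega : 0 ≤ S n)
  rw [hc] at hSn0 hSn
  refine ⟨c, by omega, by omega, fun hg => ?_, fun i hi => ?_⟩
  · have h1 : a ∣ c := by
      rw [← Int.natCast_dvd_natCast, ← hc, hnq]
      exact dvd_mul_right _ _
    have h2 : a ∣ n := by rw [ha]; exact dvd_mul_left _ _
    have := Nat.dvd_gcd h2 h1
    rw [hg, Nat.dvd_one] at this
    omega
  · obtain ⟨b1, b2⟩ := hbd i hi
    have ha0 : (0 : ℤ) < a := by omega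
    have hnc : (n : ℤ) = k * a := by exact_mod_cast ha
    -- Since `c = a * q` and `n = k * a`, the fractions `i * c / n` and `i * q / k` agree.
    have : (i * c : ℤ) / n = P i := by
      rw [Int.ediv_eq_iff_of_pos (by omega), hnc, ← hc, hnq]
      have b1' := mul_le_mul_of_nonneg_left b1 ha0.le
      have b2' := mul_lt_mul_of_pos_left b2 ha0
      constructor <;> linarith
    rw [swappedCounts, this]
    simp only [P]
    ring

lemma eq_swappedChristoffel_of_prefix_suffix {w : List Bool}
    (hw : w ∈ minimalForbiddenWords sturmianLanguage)
    (hex : ∃ k ≤ w.length,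
      prefixCount w w.length + 2 ≤ prefixCount w k + prefixCount w (w.length - k)) :
    ∃ c : ℕ, 0 < c ∧ c < w.length ∧ Nat.gcd w.length c ≠ 1 ∧
      w = swappedChristoffel w.length c := by
  obtain ⟨c, hc, hcn, hg, h⟩ := eq_swappedCounts (prefixCount_zero w)
    (fun i hi => by rw [prefixCount_succ w hi]; split_ifs <;> omega)
    ((mem_minimalForbiddenWords_iff w).1 hw).2 hex
  refine ⟨c, hc, hcn, hg, (eq_of_prefixCount_eq (length_wordOfCounts _ _) fun i hi => ?_).symm⟩
  rw [h i hi]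
  exact prefixCount_swappedChristoffel hc hcn hi

/-- The minimal forbidden words of the balanced binary words. -/
lemma mem_minimalForbiddenWords_iff_exists (w : List Bool) :
    w ∈ minimalForbiddenWords sturmianLanguage ↔ ∃ c : ℕ, 0 < c ∧ c < w.length ∧
      Nat.gcd w.length c ≠ 1 ∧ (w = swappedChristoffel w.length c ∨
        w = (swappedChristoffel w.length c).reverse) := by
  constructor
  · intro hw
    obtain ⟨hb, hH⟩ := (mem_minimalForbiddenWords_iff w).1 hw
    rw [isBalancedWord_iff] at hb
    push Not at hb
    obtain ⟨i, j, m, hi, hj, hv⟩ := hb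
    have key : (i = 0 ∧ j + m = w.length) ∨ (j = 0 ∧ i + m = w.length) := by
      by_contra hne
      have := hH i j m hi hj (by omega) (by omega)
      omega
    rcases key with ⟨rfl, hjm⟩ | ⟨rfl, him⟩
    · obtain ⟨c, h1, h2, h3, h4⟩ := eq_swappedChristoffel_of_prefix_suffix hw
        ⟨m, by omega, by
          rw [hjm, zero_add, prefixCount_zero] at hv
          rw [show w.length - m = j by omega]; linarith⟩
      exact ⟨c, h1, h2, h3, Or.inl h4⟩
    · obtain ⟨c, h1, h2, h3, h4⟩ := eq_swappedChristoffel_of_prefix_suffix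
        (reverse_mem_minimalForbiddenWords hw)
        ⟨m, by simp; omega, by
          rw [him, zero_add, prefixCount_zero] at hv
          simp only [prefixCount_reverse, List.length_reverse, Nat.sub_self, prefixCount_zero,
            show w.length - m = i by omega, show w.length - i = m by omega]
          linarith⟩
      rw [List.length_reverse] at h2 h3 h4
      exact ⟨c, h1, h2, h3, Or.inr (by rw [← h4, List.reverse_reverse])⟩
  · rintro ⟨c, h1, h2, h3, h | h⟩
    · rw [h]
      exact swappedChristoffel_mem h1 h2 h3
    · rw [h]
      exact reverse_mem_minimalForbiddenWords (swappedChristoffel_mem h1 h2 h3)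

/-! ### Counting -/

lemma count_swappedChristoffel {n c : ℕ} (hc : 0 < c) (hcn : c < n) :
    (swappedChristoffel n c).count true = c := by
  have h := prefixCount_swappedChristoffel hc hcn le_rfl
  have hl : (swappedChristoffel n c).length = n := length_wordOfCounts _ _
  rw [swappedCounts_self (by omega), prefixCount, List.take_of_length_le hl.le] at h
  exact_mod_cast h

/-- The first letter tells them apart: a swapped Christoffel word begins with `true` and ends with
`false`. -/
lemma swappedChristoffel_ne_reverse {n b c : ℕ} (hb : 0 < b) (hbn : b < n) (hc : 0 < c)
    (hcn : c < n) : swappedChristoffel n b ≠ (swappedChristoffel n c).reverse := by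
  intro h
  have h1 := congrArg (prefixCount · 1) h
  have hl : (swappedChristoffel n c).length = n := length_wordOfCounts _ _
  simp only [prefixCount_reverse, hl] at h1
  rw [prefixCount_swappedChristoffel hb hbn (by omega),
    prefixCount_swappedChristoffel hc hcn le_rfl,
    prefixCount_swappedChristoffel hc hcn (by omega), swappedCounts_of_lt one_pos (by omega),
    swappedCounts_self (by omega), swappedCounts_of_lt (by omega) (by omega),
    Nat.cast_sub (by omega)] at h1
  have e1 : ((1 : ℕ) * b : ℤ) / n = 0 := Int.ediv_eq_zero_of_lt (by positivity) (by omega)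
  have e2 : ((n - (1 : ℕ) : ℤ) * c) / n = c - 1 := by
    rw [Int.ediv_eq_iff_of_pos (by omega)]
    push_cast
    constructor <;> nlinarith
  rw [e1, e2] at h1
  omega

lemma card_filter_gcd_ne_one {n : ℕ} (hn : 1 < n) :
    ((((Finset.range n).filter fun c => 0 < c ∧ Nat.gcd n c ≠ 1).card : ℕ) : ℤ) =
      n - 1 - Nat.totient n := by
  have h1 := Finset.card_filter_add_card_filter_not (s := Finset.range n) (fun c => n.Coprime c)
  have h2 : (Finset.range n).filter (fun c => ¬ n.Coprime c) =
      insert 0 ((Finset.range n).filter fun c => 0 < c ∧ Nat.gcd n c ≠ 1) := by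
    ext c
    rcases Nat.eq_zero_or_pos c with rfl | hc
    · simp; omega
    · simp [hc, hc.ne', Nat.Coprime]
  rw [h2, Finset.card_insert_of_notMem (by simp), Finset.card_range,
    ← Nat.totient_eq_card_coprime] at h1
  omega

theorem mainTheorem5 (n : ℕ) (hn : 1 < n) :
    (wordCount (minimalForbiddenWords sturmianLanguage) n : ℤ)
      = 2 * ((n : ℤ) - 1 - (Nat.totient n : ℤ)) := by
  classical
  set C := (Finset.range n).filter fun c => 0 < c ∧ Nat.gcd n c ≠ 1 with hC
  have hmem : ∀ {c}, c ∈ C ↔ c < n ∧ 0 < c ∧ Nat.gcd n c ≠ 1 := by simp [hC]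
  have hset : {w : List Bool | w ∈ minimalForbiddenWords sturmianLanguage ∧ w.length = n} =
      ↑(C.image (swappedChristoffel n) ∪
        C.image fun c => (swappedChristoffel n c).reverse) := by
    ext w
    simp only [Set.mem_ofPred_eq, Finset.coe_union, Finset.coe_image, Set.mem_union, Set.mem_image,
      Finset.mem_coe, mem_minimalForbiddenWords_iff_exists]
    have hl : ∀ c, (swappedChristoffel n c).length = n := fun c => length_wordOfCounts _ _
    constructor
    · rintro ⟨⟨c, h1, h2, h3, h | h⟩, rfl⟩
      · exact Or.inl ⟨c, hmem.2 ⟨h2, h1, h3⟩, h.symm⟩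
      · exact Or.inr ⟨c, hmem.2 ⟨h2, h1, h3⟩, h.symm⟩
    · rintro (⟨c, hc, rfl⟩ | ⟨c, hc, rfl⟩)
      · rw [hl]
        exact ⟨⟨c, (hmem.1 hc).2.1, (hmem.1 hc).1, (hmem.1 hc).2.2, Or.inl rfl⟩, rfl⟩
      · rw [List.length_reverse, hl]
        exact ⟨⟨c, (hmem.1 hc).2.1, (hmem.1 hc).1, (hmem.1 hc).2.2, Or.inr rfl⟩, rfl⟩
  have hinj : Set.InjOn (swappedChristoffel n) C := by
    intro b hb c hc h
    have hb' := hmem.1 hb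
    have hc' := hmem.1 hc
    rw [← count_swappedChristoffel hb'.2.1 hb'.1, h, count_swappedChristoffel hc'.2.1 hc'.1]
  rw [wordCount, hset, Set.ncard_coe_finset, Finset.card_union_of_disjoint,
    Finset.card_image_of_injOn hinj,
    Finset.card_image_of_injOn fun b hb c hc h => hinj hb hc (List.reverse_injective h),
    ← card_filter_gcd_ne_one hn]
  · push_cast; ring
  · rw [Finset.disjoint_left]
    simp only [Finset.mem_image]
    rintro _ ⟨b, hb, rfl⟩ ⟨c, hc, h⟩
    exact swappedChristoffel_ne_reverse (hmem.1 hb).2.1 (hmem.1 hb).1 (hmem.1 hc).2.1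
      (hmem.1 hc).1 h.symm
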